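/- For a real symmetric matrix $H\in\mathbb R^{d\times d}$ let $\lambda_{\max}(H)$ be its largest eigenvalue, $\mathrm{intdim}(H)=\mathrm{Tr}(H)/\|H\|_{\mathrm{op}}$, and for $M\in\mathbb R^{d\times d}$ let $\rho=\mathrm{Tr}(M^\top H M)/\lambda_{\max}(H)$. There are absolute constants $c_1,c_2>0$ such that the following holds for every $d$, every real $r\le d$, and every symmetric positive semidefinite $H\in\mathbb R^{d\times d}$ with $\lambda_{\max}(H)>0$ and $\mathrm{intdim}(H)\le r$. In each of the three cases below, $M$ is a random matrix, $\rho$ is integrable with $$\mathbb E[\rho]=\frac{s\,\mathrm{Tr}(H)}{d\,\lambda_{\max}(H)},$$ and for every real $\widehat\rho>\mathbb E[\rho]$, with $\Delta=\widehat\rho-\mathbb E[\rho]$, the stated tail formula holds. 1. (Low-rank projection) $s$ is an integer, $1\le s\le d$, $M=UU^\top$, where $U\in\mathbb R^{d\times s}$ is a random matrix with orthonormal columns whose column span is uniformly distributed on the Grassmannian $\mathrm{Gr}(s,\mathbb R^d)$. Then $\mathbb P(\rho\ge\widehat\rho)\le 2\exp\!\big(-c_1\,d\Delta^2/s\big)$.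 2. (Sparse perturbation) $s$ is real, $0<s\le d$, $M=\mathrm{diag}(m_1,\dots,m_d)$ with independent $m_i\sim\mathrm{Bernoulli}(s/d)$. Then $\mathbb P(\rho\ge\widehat\rho)\le c_2\,\dfrac{rs}{d\Delta^2}$. 3. (Block sparse perturbation) $s\ge1$ is an integer, $\{1,\dots,d\}$ is partitioned into $N$ blocks $B_1,\dots,B_N$ of size $s$ each, $J$ is uniform on $\{1,\dots,N\}$, and $M=\mathrm{diag}(m)$ with $m_i=1$ if $i\in B_J$ and $m_i=0$ otherwise. Then $$\mathbb P(\rho\ge\widehat\rho)=\frac1N\Big|\Big\{j:\ \sum_{i\in B_j}H_{ii}\ge\lambda_{\max}(H)\,\widehat\rho\Big\}\Big|=\frac{k_\#(\widehat\rho)\,s}{d},$$ where $k_\#(\widehat\rho)$ is the number of blocks $B_j$ with $\sum_{i\in B_j}H_{ii}\ge\lambda_{\max}(H)\,\widehat\rho$. -/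

import Mathlib

open MeasureTheory ProbabilityTheory
open scoped Matrix

namespace SubspaceAlignment

noncomputable section

/-! ### Spectral quantities and the subspace alignment -/

/-- The largest eigenvalue `λ_max(A)` of a real (symmetric) matrix. -/
def lambdaMax {d : ℕ} (A : Matrix (Fin d) (Fin d) ℝ) : ℝ :=
  sSup (spectrum ℝ A)

/-- The intrinsic dimension `Tr(A) / ‖A‖_op`, with the Euclidean operator norm. -/
def intdim {d : ℕ} (A : Matrix (Fin d) (Fin d) ℝ) : ℝ :=
  A.trace / ‖Matrix.toEuclideanCLM (n := Fin d) (𝕜 := ℝ) A‖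

/-- The subspace alignment `ρ = Tr(Mᵀ H M) / λ_max(H)` of `M` with `H`. -/
def alignment {d : ℕ} (H M : Matrix (Fin d) (Fin d) ℝ) : ℝ :=
  (Mᵀ * H * M).trace / lambdaMax H

/-! ### The Grassmannian and its uniform probability measure -/

/-- Real `d × s` matrices with `s` orthonormal columns. -/
abbrev Stiefel (d s : ℕ) : Type :=
  {U : Matrix (Fin d) (Fin s) ℝ // Uᵀ * U = 1}

/-- The Grassmannian `Gr(s, ℝ^d)` of `s`-dimensional linear subspaces of `ℝ^d`. -/
def Grassmannian (d s : ℕ) : Type :=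
  {V : Submodule ℝ (EuclideanSpace ℝ (Fin d)) // Module.finrank ℝ V = s}

/-- The entries, in the standard basis, of the orthogonal projection onto `V`. -/
def Grassmannian.proj {d s : ℕ} (V : Grassmannian d s) : Fin d → Fin d → ℝ :=
  fun i j => V.1.starProjection (EuclideanSpace.single j (1 : ℝ)) i

/-- The Borel σ-algebra of the Grassmannian, embedded in the `d × d` matrices by sending a
subspace to its orthogonal projection. -/
instance (d s : ℕ) : MeasurableSpace (Grassmannian d s) :=
  MeasurableSpace.comap Grassmannian.proj inferInstance

theorem finrank_columnSpan {d s : ℕ} (U : Stiefel d s) :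
    Module.finrank ℝ (LinearMap.range (Matrix.toEuclideanLin (𝕜 := ℝ) U.1)) = s := by
  have h : Function.Injective (Matrix.toEuclideanLin (𝕜 := ℝ) U.1) := by
    intro x y hxy
    have h2 : U.1 *ᵥ x.ofLp = U.1 *ᵥ y.ofLp := by
      have := congrArg WithLp.ofLp hxy
      simpa using this
    have h3 := congrArg (fun v => U.1ᵀ *ᵥ v) h2
    simp only [Matrix.mulVec_mulVec, U.2, Matrix.one_mulVec] at h3
    exact WithLp.ofLp_injective 2 h3
  rw [LinearMap.finrank_range_of_inj h]
  simp

/-- The span of the columns of a matrix with orthonormal columns. -/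
def columnSpan {d s : ℕ} (U : Stiefel d s) : Grassmannian d s :=
  ⟨LinearMap.range (Matrix.toEuclideanLin (𝕜 := ℝ) U.1), finrank_columnSpan U⟩

/-- The first `s` columns of an orthogonal `d × d` matrix. -/
def firstColumns {d s : ℕ} (h : s ≤ d) (Q : Matrix.orthogonalGroup (Fin d) ℝ) : Stiefel d s :=
  ⟨Q.1.submatrix id (Fin.castLE h), by
    have hQ : Q.1ᵀ * Q.1 = 1 := (Matrix.mem_orthogonalGroup_iff' (Fin d) ℝ).1 Q.2
    have h2 := Matrix.submatrix_mul Q.1ᵀ Q.1 (Fin.castLE h) id (Fin.castLE h)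
      Function.bijective_id
    rw [Matrix.transpose_submatrix, ← h2, hQ]
    exact Matrix.submatrix_one _ (Fin.castLE_injective h)⟩

instance (d : ℕ) : CompactSpace (Matrix.orthogonalGroup (Fin d) ℝ) := by
  refine isCompact_iff_compactSpace.1 (?_ : IsCompact
    ((Matrix.orthogonalGroup (Fin d) ℝ : Submonoid _) : Set (Matrix (Fin d) (Fin d) ℝ)))
  have hK : IsCompact (Set.univ.pi fun _ : Fin d => Set.univ.pi fun _ : Fin d =>
      Set.Icc (-1 : ℝ) 1) :=
    isCompact_univ_pi fun _ => isCompact_univ_pi fun _ => isCompact_Icc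
  refine IsCompact.of_isClosed_subset hK isClosed_unitary ?_
  intro Q hQ i _ j _
  exact abs_le.1 (by simpa using entry_norm_bound_of_unitary hQ i j)

instance (d : ℕ) : MeasurableSpace (Matrix.orthogonalGroup (Fin d) ℝ) := borel _

instance (d : ℕ) : BorelSpace (Matrix.orthogonalGroup (Fin d) ℝ) := ⟨rfl⟩

/-- The Haar probability measure on the orthogonal group `O(d)`. -/
def haarOrthogonal (d : ℕ) : Measure (Matrix.orthogonalGroup (Fin d) ℝ) :=
  Measure.haarMeasure ⊤

/-- The uniform probability measure on `Gr(s, ℝ^d)`: the law of the span of the first `s` columns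
of a Haar distributed orthogonal matrix. -/
def uniformGrassmannian {d s : ℕ} (h : s ≤ d) : Measure (Grassmannian d s) :=
  (haarOrthogonal d).map fun Q => columnSpan (firstColumns h Q)

/-! ### The three random perturbation matrices -/

/-- The low-rank projection `U Uᵀ`. -/
def lowRankProjection {d s : ℕ} (U : Stiefel d s) : Matrix (Fin d) (Fin d) ℝ :=
  U.1 * U.1ᵀ

/-- The probability `s / d`, for real `0 < s ≤ d`. -/
def maskProbability {d : ℕ} {s : ℝ} (hs : 0 < s) (hsd : s ≤ d) : unitInterval :=
  ⟨s / d, div_nonneg hs.le (Nat.cast_nonneg d), div_le_one_of_le₀ hsd (Nat.cast_nonneg d)⟩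

/-- The diagonal matrix that keeps exactly the coordinates in the block `b`. -/
def blockMask {d : ℕ} (b : Finset (Fin d)) : Matrix (Fin d) (Fin d) ℝ :=
  Matrix.diagonal fun i => if i ∈ b then 1 else 0

open Classical in
/-- The number of blocks whose diagonal mass in `H` is at least `λ_max(H) * t`. -/
def goodBlockCount {d N : ℕ} (H : Matrix (Fin d) (Fin d) ℝ) (B : Fin N → Finset (Fin d))
    (t : ℝ) : ℕ :=
  (Finset.univ.filter fun j => lambdaMax H * t ≤ ∑ i ∈ B j, H i i).card

end

end SubspaceAlignment

open SubspaceAlignment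

namespace SubspaceAlignment

/-! The low-rank case carries the work; it is Chatterjee's exchangeable-pair method. Let `f` be the
centred value of `Tr(H P)`, `P` the projection onto the random subspace. Left multiplication by a
reflection preserves Haar measure and is an involution. Conjugated into an eigenbasis of `H`,
reflections along `a e_i + b e_j` change `f` by an explicit expression in three entries of `P`
(`trace_diagonal_mul_planeReflection_conj`). Over all ordered pairs `(i, j)` the increments sum to
`-γ f` with `γ = 8a²b²d` (`sum_trace_sub_eq`), and their squares to at most `V = 48a²b²λ²s` with `λ
= λ_max(H)`, provided `4a²b²d ≤ 1` (`sum_trace_sub_sq_le`). Symmetrising under each involution gives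
`m' ≤ (V/γ) l m` for the moment generating function `m(l)`, `l ≥ 0`, hence a Gaussian upper tail
with variance proxy `V/γ = 6λ²s/d` (`measureReal_ge_le_of_sum_sub_eq_neg_mul`).

For Bernoulli masks `ρ` is almost surely a sum of independent terms `c_i m_i` with `c_i = H_ii/λ ∈
[0, 1]`. Its variance is at most `(s/d) ∑ c_i ≤ (s/d) r`, and Chebyshev's inequality concludes. For
blocks, `ρ` is a function of a uniform index, and the claim is a count using `N s = d`. -/

theorem sub_mul_exp_sub_exp_le {l x y : ℝ} (hl : 0 ≤ l) :
    (x - y) * (Real.exp (l * x) - Real.exp (l * y)) ≤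
      l * (x - y) ^ 2 * (Real.exp (l * x) + Real.exp (l * y)) := by
  -- Tangent line bound `1 + z ≤ exp z`, keeping only the larger exponential. Adding the other one
  -- makes the estimate symmetric in `x` and `y`; the constant is not optimal.
  have key : ∀ a b : ℝ, b ≤ a → (a - b) * (Real.exp (l * a) - Real.exp (l * b)) ≤
      l * (a - b) ^ 2 * Real.exp (l * a) := by
    intro a b hab
    have h1 : Real.exp (l * a) - Real.exp (l * b) ≤ l * (a - b) * Real.exp (l * a) := by
      have h2 := Real.add_one_le_exp (l * b - l * a)
      have h3 : Real.exp (l * b) = Real.exp (l * b - l * a) * Real.exp (l * a) := by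
        rw [← Real.exp_add]; ring_nf
      rw [h3]
      nlinarith [Real.exp_pos (l * a)]
    calc _ ≤ (a - b) * (l * (a - b) * Real.exp (l * a)) :=
          mul_le_mul_of_nonneg_left h1 (sub_nonneg.2 hab)
      _ = _ := by ring
  have hx : 0 ≤ l * (x - y) ^ 2 * Real.exp (l * x) := by positivity
  have hy : 0 ≤ l * (x - y) ^ 2 * Real.exp (l * y) := by positivity
  rcases le_total y x with h | h
  · linarith [key x y h]
  · linarith [key y x h, show (y - x) ^ 2 = (x - y) ^ 2 by ring]

theorem integral_comp_measurePreserving {Ω : Type*} [MeasurableSpace Ω] {μ : Measure Ω} {S : Ω → Ω}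
    (hS : MeasurePreserving S μ μ) {g : Ω → ℝ} (hg : Integrable g μ) :
    ∫ x, g (S x) ∂μ = ∫ x, g x ∂μ := by
  have h := integral_map (μ := μ) hS.measurable.aemeasurable (f := g)
    (by rw [hS.map_eq]; exact hg.aestronglyMeasurable)
  rw [hS.map_eq] at h
  exact h.symm

/-! ### Sub-Gaussian tails for eigenfunctions of random walks by involutions. -/

section Concentration

variable {Ω ι : Type*} [MeasurableSpace Ω] {μ : Measure Ω} [IsProbabilityMeasure μ] [Fintype ι]
  {T : ι → Ω → Ω} {f : Ω → ℝ} {K γ V : ℝ}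

theorem integrable_continuous_comp_pair {S : Ω → Ω} (hS : Measurable S)
    (hf : Measurable f) (hK : ∀ x, |f x| ≤ K) {g : ℝ × ℝ → ℝ} (hg : Continuous g) :
    Integrable (fun x => g (f x, f (S x))) μ := by
  obtain ⟨C, hC⟩ := ((isCompact_Icc (a := -K) (b := K)).prod
    (isCompact_Icc (a := -K) (b := K))).exists_bound_of_continuousOn hg.continuousOn
  refine Integrable.of_bound
    (hg.measurable.comp (hf.prodMk (hf.comp hS))).aestronglyMeasurable C (ae_of_all _ fun x => ?_)
  exact hC _ ⟨abs_le.1 (hK x), abs_le.1 (hK (S x))⟩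

/-- Each increment integrates to zero by invariance, so `γ ∫ f = 0`. This yields the mean of `ρ`
without a separate computation. -/
theorem integral_eq_zero_of_sum_sub_eq_neg_mul (hT : ∀ k, MeasurePreserving (T k) μ μ)
    (hf : Measurable f) (hK : ∀ x, |f x| ≤ K) (hγ : 0 < γ)
    (hlin : ∀ x, ∑ k, (f (T k x) - f x) = -γ * f x) : ∫ x, f x ∂μ = 0 := by
  have hfi : Integrable f μ :=
    Integrable.of_bound hf.aestronglyMeasurable K (ae_of_all _ hK)
  have hfT : ∀ k, Integrable (fun x => f (T k x)) μ := fun k =>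
    (hT k).integrable_comp_of_integrable hfi
  have h2 : ∫ x, ∑ k, (f (T k x) - f x) ∂μ = 0 := by
    refine (integral_finsetSum _ fun k _ => (hfT k).sub hfi).trans ?_
    refine Finset.sum_eq_zero fun k _ => ?_
    refine (integral_sub (hfT k) hfi).trans ?_
    rw [integral_comp_measurePreserving (hT k) hfi, sub_self]
  simp_rw [hlin] at h2
  rw [integral_const_mul] at h2
  rcases mul_eq_zero.1 h2 with h | h
  · linarith
  · exact h

/-- Replace `γ f` by `∑ (f - f ∘ T k)`. Since `T k` is a measure preserving involution, each term
equals half the integral of `(f - f ∘ T k)(exp(l f) - exp(l f ∘ T k))`, which is quadratic in the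
increment by `sub_mul_exp_sub_exp_le`. -/
theorem mul_integral_mul_exp_le (hT : ∀ k, MeasurePreserving (T k) μ μ)
    (hinv : ∀ k x, T k (T k x) = x) (hf : Measurable f) (hK : ∀ x, |f x| ≤ K)
    (hlin : ∀ x, ∑ k, (f (T k x) - f x) = -γ * f x)
    (hquad : ∀ x, ∑ k, (f (T k x) - f x) ^ 2 ≤ V) {l : ℝ} (hl : 0 ≤ l) :
    γ * ∫ x, f x * Real.exp (l * f x) ∂μ ≤ l * V * ∫ x, Real.exp (l * f x) ∂μ := by
  have hint : ∀ k, ∀ g : ℝ × ℝ → ℝ, Continuous g →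
      Integrable (fun x => g (f x, f (T k x))) μ := fun k g hg =>
    integrable_continuous_comp_pair (hT k).measurable hf hK hg
  have hA : ∀ k, Integrable (fun x => (f x - f (T k x)) * Real.exp (l * f x)) μ := fun k =>
    hint k (fun p => (p.1 - p.2) * Real.exp (l * p.1)) (by fun_prop)
  have hA' : ∀ k, Integrable (fun x => (f x - f (T k x)) * Real.exp (l * f (T k x))) μ := fun k =>
    hint k (fun p => (p.1 - p.2) * Real.exp (l * p.2)) (by fun_prop)
  have hB : ∀ k, Integrable (fun x => (f x - f (T k x)) ^ 2 * Real.exp (l * f x)) μ := fun k =>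
    hint k (fun p => (p.1 - p.2) ^ 2 * Real.exp (l * p.1)) (by fun_prop)
  have hB' : ∀ k, Integrable (fun x => (f x - f (T k x)) ^ 2 * Real.exp (l * f (T k x))) μ :=
    fun k => hint k (fun p => (p.1 - p.2) ^ 2 * Real.exp (l * p.2)) (by fun_prop)
  have hE : Integrable (fun x => Real.exp (l * f x)) μ :=
    integrable_continuous_comp_pair (S := id) measurable_id hf hK
      (g := fun p => Real.exp (l * p.1)) (by fun_prop)
  have hstep : ∀ k, ∫ x, (f x - f (T k x)) * Real.exp (l * f x) ∂μ ≤
      l * ∫ x, (f x - f (T k x)) ^ 2 * Real.exp (l * f x) ∂μ := by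
    intro k
    -- The substitution `x ↦ T k x` swaps `f` and `f ∘ T k`. It doubles both the left side and,
    -- through the symmetric bound, the right side, so the factors cancel.
    have h1 := integral_comp_measurePreserving (hT k) (hA k)
    have h2 := integral_comp_measurePreserving (hT k) (hB k)
    simp only [hinv] at h1 h2
    have h3 : ∫ x, (f (T k x) - f x) * Real.exp (l * f (T k x)) ∂μ =
        -∫ x, (f x - f (T k x)) * Real.exp (l * f (T k x)) ∂μ := by
      rw [← integral_neg]; congr 1; ext x; ring
    have h4 : ∫ x, (f (T k x) - f x) ^ 2 * Real.exp (l * f (T k x)) ∂μ =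
        ∫ x, (f x - f (T k x)) ^ 2 * Real.exp (l * f (T k x)) ∂μ := by
      congr 1; ext x; ring
    have h5 : ∫ x, ((f x - f (T k x)) * Real.exp (l * f x) -
          (f x - f (T k x)) * Real.exp (l * f (T k x))) ∂μ ≤
        ∫ x, l * ((f x - f (T k x)) ^ 2 * Real.exp (l * f x) +
          (f x - f (T k x)) ^ 2 * Real.exp (l * f (T k x))) ∂μ := by
      refine integral_mono ((hA k).sub (hA' k)) (((hB k).add (hB' k)).const_mul l) fun x => ?_
      have := sub_mul_exp_sub_exp_le (x := f x) (y := f (T k x)) hl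
      simp only
      linarith
    rw [integral_sub (hA k) (hA' k), integral_const_mul, integral_add (hB k) (hB' k)] at h5
    rw [← h4, h2] at h5
    linarith
  calc γ * ∫ x, f x * Real.exp (l * f x) ∂μ
      = ∫ x, ∑ k, (f x - f (T k x)) * Real.exp (l * f x) ∂μ := by
        rw [← integral_const_mul]
        congr 1; ext x
        rw [← Finset.sum_mul, ← mul_assoc, show γ * f x = -∑ k, (f (T k x) - f x) by
          rw [hlin]; ring, ← Finset.sum_neg_distrib]
        simp
    _ = ∑ k, ∫ x, (f x - f (T k x)) * Real.exp (l * f x) ∂μ :=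
        integral_finsetSum _ fun k _ => hA k
    _ ≤ ∑ k, l * ∫ x, (f x - f (T k x)) ^ 2 * Real.exp (l * f x) ∂μ :=
        Finset.sum_le_sum fun k _ => hstep k
    _ = l * ∫ x, ∑ k, (f x - f (T k x)) ^ 2 * Real.exp (l * f x) ∂μ := by
        rw [integral_finsetSum _ fun k _ => hB k, Finset.mul_sum]
    _ ≤ l * ∫ x, V * Real.exp (l * f x) ∂μ := by
        refine mul_le_mul_of_nonneg_left (integral_mono
          (integrable_finsetSum _ fun k _ => hB k) (hE.const_mul V) fun x => ?_) hl
        simp only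
        rw [← Finset.sum_mul]
        refine mul_le_mul_of_nonneg_right ?_ (Real.exp_pos _).le
        refine le_trans (le_of_eq ?_) (hquad x)
        exact Finset.sum_congr rfl fun k _ => by ring
    _ = _ := by rw [integral_const_mul]; ring

/-- Grönwall's argument: by `mul_integral_mul_exp_le`, the moment generating function divided by the
Gaussian one is antitone on `[0, ∞)`, and it equals `1` at `0`. -/
theorem mgf_le_exp_of_sum_sub_eq_neg_mul (hT : ∀ k, MeasurePreserving (T k) μ μ)
    (hinv : ∀ k x, T k (T k x) = x) (hf : Measurable f) (hK : ∀ x, |f x| ≤ K) (hγ : 0 < γ)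
    (hlin : ∀ x, ∑ k, (f (T k x) - f x) = -γ * f x)
    (hquad : ∀ x, ∑ k, (f (T k x) - f x) ^ 2 ≤ V) {l : ℝ} (hl : 0 ≤ l) :
    mgf f μ l ≤ Real.exp (V / γ * l ^ 2 / 2) := by
  have hset : integrableExpSet f μ = Set.univ := Set.eq_univ_of_forall fun t =>
    integrable_continuous_comp_pair (S := id) measurable_id hf hK
      (g := fun p => Real.exp (t * p.1)) (by fun_prop)
  have hder : ∀ t : ℝ, HasDerivAt (mgf f μ) (∫ x, f x * Real.exp (t * f x) ∂μ) t := fun t =>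
    hasDerivAt_mgf (by simp [hset])
  have hder' : ∀ t : ℝ, HasDerivAt (fun t => mgf f μ t * Real.exp (-(V / γ * t ^ 2 / 2)))
      ((∫ x, f x * Real.exp (t * f x) ∂μ) * Real.exp (-(V / γ * t ^ 2 / 2)) +
        mgf f μ t * (Real.exp (-(V / γ * t ^ 2 / 2)) * (-(V / γ * t)))) t := by
    intro t
    refine (hder t).mul (HasDerivAt.exp ?_)
    convert! (((hasDerivAt_pow 2 t).const_mul (V / γ)).div_const 2).neg using 1
    simp; ring
  have hanti : AntitoneOn (fun t => mgf f μ t * Real.exp (-(V / γ * t ^ 2 / 2))) (Set.Ici 0) := by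
    refine antitoneOn_of_deriv_nonpos (convex_Ici 0)
      (fun t _ => (hder' t).continuousAt.continuousWithinAt)
      (fun t _ => (hder' t).differentiableAt.differentiableWithinAt) fun t ht => ?_
    rw [interior_Ici, Set.mem_Ioi] at ht
    rw [(hder' t).deriv]
    have h := mul_integral_mul_exp_le hT hinv hf hK hlin hquad ht.le
    have h' : ∫ x, f x * Real.exp (t * f x) ∂μ ≤ V / γ * t * mgf f μ t := by
      rw [mgf, show V / γ * t * ∫ x, Real.exp (t * f x) ∂μ =
        (t * V * ∫ x, Real.exp (t * f x) ∂μ) / γ by ring, le_div_iff₀ hγ]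
      linarith
    have := mul_le_mul_of_nonneg_right h' (Real.exp_pos (-(V / γ * t ^ 2 / 2))).le
    linarith
  have h := hanti (Set.mem_Ici.2 le_rfl) (Set.mem_Ici.2 hl) hl
  simp only [mgf_zero] at h
  rw [Real.exp_neg, ← div_eq_mul_inv, div_le_iff₀ (Real.exp_pos _)] at h
  simpa using h

/-- A bounded eigenfunction of a finite random walk by measure preserving involutions, whose
increments have bounded squared sum, has sub-Gaussian upper tails. -/
theorem measureReal_ge_le_of_sum_sub_eq_neg_mul (hT : ∀ k, MeasurePreserving (T k) μ μ)
    (hinv : ∀ k x, T k (T k x) = x) (hf : Measurable f) (hK : ∀ x, |f x| ≤ K) (hγ : 0 < γ)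
    (hV : 0 < V) (hlin : ∀ x, ∑ k, (f (T k x) - f x) = -γ * f x)
    (hquad : ∀ x, ∑ k, (f (T k x) - f x) ^ 2 ≤ V) {t : ℝ} (ht : 0 ≤ t) :
    μ.real {x | t ≤ f x} ≤ Real.exp (-(t ^ 2 * γ / (2 * V))) := by
  -- The Chernoff parameter `t γ / V` minimises `-l t + (V / γ) l² / 2`.
  have hl : 0 ≤ t * γ / V := by positivity
  refine (measure_ge_le_exp_mul_mgf t hl
    (integrable_continuous_comp_pair (S := id) measurable_id hf hK
      (g := fun p => Real.exp (t * γ / V * p.1)) (by fun_prop))).trans ?_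
  refine (mul_le_mul_of_nonneg_left
    (mgf_le_exp_of_sum_sub_eq_neg_mul hT hinv hf hK hγ hlin hquad hl) (Real.exp_pos _).le).trans ?_
  rw [← Real.exp_add]
  refine le_of_eq (congrArg _ ?_)
  field_simp
  ring

end Concentration

/-! ### Plane reflections acting on symmetric matrices and projections. -/

section Reflection

variable {d : ℕ}

/-- The vector `a e_i + b e_j`. -/
def planeVector (a b : ℝ) (i j : Fin d) : Fin d → ℝ := Pi.single i a + Pi.single j b

/-- The reflection `1 - 2 u uᵀ` along `u = a e_i + b e_j` for `i ≠ j`, and `1` for `i = j`. -/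
def planeReflection (a b : ℝ) (i j : Fin d) : Matrix (Fin d) (Fin d) ℝ :=
  if i = j then 1 else
    1 - (2 : ℝ) • Matrix.vecMulVec (planeVector a b i j) (planeVector a b i j)

theorem planeVector_dotProduct_self {a b : ℝ} (hab : a ^ 2 + b ^ 2 = 1) {i j : Fin d}
    (hij : i ≠ j) : planeVector a b i j ⬝ᵥ planeVector a b i j = 1 := by
  simp [planeVector, hij, hij.symm, ← hab]
  ring

theorem planeReflection_transpose (a b : ℝ) (i j : Fin d) :
    (planeReflection a b i j)ᵀ = planeReflection a b i j := by
  unfold planeReflection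
  split_ifs
  · simp
  · simp [Matrix.transpose_vecMulVec]

theorem planeReflection_mul_self {a b : ℝ} (hab : a ^ 2 + b ^ 2 = 1) (i j : Fin d) :
    planeReflection a b i j * planeReflection a b i j = 1 := by
  unfold planeReflection
  split_ifs with hij
  · simp
  · simp only [Matrix.sub_mul, Matrix.mul_sub, Matrix.one_mul, Matrix.mul_one, Matrix.smul_mul,
      Matrix.mul_smul, Matrix.vecMulVec_mul_vecMulVec, planeVector_dotProduct_self hab hij,
      one_smul]
    module

/-- Expanding `(1 - 2uuᵀ) p (1 - 2uuᵀ)` leaves rank-one corrections, and against a diagonal matrix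
only the coordinates `i, j` contribute. The diagonal difference, of order `a²b²`, is the drift; the
off-diagonal entry, of order `ab`, is the fluctuation. -/
theorem trace_diagonal_mul_planeReflection_conj {a b : ℝ} (hab : a ^ 2 + b ^ 2 = 1)
    (h : Fin d → ℝ) {p : Matrix (Fin d) (Fin d) ℝ} (hp : pᵀ = p) (i j : Fin d) :
    (Matrix.diagonal h * (planeReflection a b i j * p * planeReflection a b i j)).trace -
        (Matrix.diagonal h * p).trace =
      (h i - h j) * (4 * a ^ 2 * b ^ 2 * (p j j - p i i) -
        4 * (1 - 2 * a ^ 2) * a * b * p i j) := by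
  unfold planeReflection
  split_ifs with hij
  · simp [hij]
  have hpij : p j i = p i j := congrFun (congrFun hp i) j
  set u := planeVector a b i j with hu
  have hmul : ∀ g : Fin d → ℝ, (Matrix.diagonal h * Matrix.vecMulVec u g).trace =
      h i * a * g i + h j * b * g j := by
    intro g
    simp only [Matrix.trace, Matrix.diag_apply, Matrix.diagonal_mul, Matrix.vecMulVec_apply, hu,
      planeVector, Pi.add_apply, Pi.single_apply]
    simp only [add_mul, mul_add, ite_mul, mul_ite, zero_mul, mul_zero, Finset.sum_add_distrib,
      Finset.sum_ite_eq', Finset.mem_univ, if_true]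
    simp [mul_assoc]
  have hmul' : ∀ g : Fin d → ℝ, (Matrix.diagonal h * Matrix.vecMulVec g u).trace =
      h i * a * g i + h j * b * g j := by
    intro g
    rw [← hmul g]
    simp only [Matrix.trace, Matrix.diag_apply, Matrix.diagonal_mul, Matrix.vecMulVec_apply]
    exact Finset.sum_congr rfl fun _ _ => by ring
  have hup : u ᵥ* p = p *ᵥ u := by
    conv_lhs => rw [← hp, Matrix.vecMul_transpose]
  have hexp : (1 - (2 : ℝ) • Matrix.vecMulVec u u) * p * (1 - (2 : ℝ) • Matrix.vecMulVec u u) =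
      p - (2 : ℝ) • Matrix.vecMulVec u (p *ᵥ u) - (2 : ℝ) • Matrix.vecMulVec (p *ᵥ u) u +
        (4 * ((p *ᵥ u) ⬝ᵥ u)) • Matrix.vecMulVec u u := by
    have h1 : Matrix.vecMulVec u u * p = Matrix.vecMulVec u (p *ᵥ u) := by
      rw [Matrix.vecMulVec_mul, hup]
    have h2 : p * Matrix.vecMulVec u u = Matrix.vecMulVec (p *ᵥ u) u := by
      rw [Matrix.mul_vecMulVec]
    have h3 : Matrix.vecMulVec u (p *ᵥ u) * Matrix.vecMulVec u u =
        ((p *ᵥ u) ⬝ᵥ u) • Matrix.vecMulVec u u := by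
      rw [Matrix.vecMulVec_mul_vecMulVec]
      simp
    simp only [Matrix.sub_mul, Matrix.mul_sub, Matrix.one_mul, Matrix.mul_one, Matrix.smul_mul,
      Matrix.mul_smul, h1, h2, h3]
    module
  have hui : u i = a := by simp [hu, planeVector, hij]
  have huj : u j = b := by simp [hu, planeVector, Ne.symm hij]
  have hpu : ∀ k, (p *ᵥ u) k = p k i * a + p k j * b := by
    intro k
    simp [hu, planeVector, Matrix.mulVec_add, mul_comm]
  have hq : (p *ᵥ u) ⬝ᵥ u = a * (p i i * a + p i j * b) + b * (p i j * a + p j j * b) := by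
    rw [hu, planeVector, dotProduct_add, dotProduct_single, dotProduct_single, ← planeVector, ← hu,
      hpu, hpu, hpij]
    ring
  rw [hexp]
  simp only [Matrix.mul_add, Matrix.mul_sub, Matrix.mul_smul, Matrix.trace_add, Matrix.trace_sub,
    Matrix.trace_smul, hmul, hmul', hpu, hq, hui, huj, hpij, smul_eq_mul]
  -- The two sides differ by a multiple of `a² + b² - 1`, with this cofactor.
  linear_combination
    (4 * h i * a ^ 2 * p i i + 8 * a * b * p i j * h j + 4 * b ^ 2 * h j * p j j) * hab

theorem sum_sub_mul_sub (h q : Fin d → ℝ) :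
    ∑ k : Fin d × Fin d, (h k.1 - h k.2) * (q k.2 - q k.1) =
      -2 * (d * ∑ i, h i * q i - (∑ i, q i) * ∑ i, h i) := by
  rw [Fintype.sum_prod_type]
  have hi : ∀ i, ∑ j, (h i - h j) * (q j - q i) =
      h i * ∑ j, q j - d * (h i * q i) - ∑ j, h j * q j + q i * ∑ j, h j := by
    intro i
    have hc : (d : ℝ) * (h i * q i) = ∑ _j : Fin d, h i * q i := by simp
    rw [Finset.mul_sum, Finset.mul_sum, hc, ← Finset.sum_sub_distrib, ← Finset.sum_sub_distrib,
      ← Finset.sum_add_distrib]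
    exact Finset.sum_congr rfl fun j _ => by ring
  have hc : ∑ _i : Fin d, ∑ j, h j * q j = d * ∑ j, h j * q j := by simp
  simp_rw [hi]
  rw [Finset.sum_add_distrib, Finset.sum_sub_distrib, Finset.sum_sub_distrib, ← Finset.sum_mul,
    ← Finset.sum_mul, ← Finset.mul_sum, hc]
  ring

/-- The off-diagonal part is antisymmetric under swapping `i` and `j`, so it cancels over ordered
pairs. Only the drift survives, and it is linear in the centred trace. -/
theorem sum_trace_sub_eq {a b : ℝ} (hab : a ^ 2 + b ^ 2 = 1)
    (h : Fin d → ℝ) {p : Matrix (Fin d) (Fin d) ℝ} (hp : pᵀ = p) :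
    ∑ k : Fin d × Fin d,
      ((Matrix.diagonal h * (planeReflection a b k.1 k.2 * p * planeReflection a b k.1 k.2)).trace -
        (Matrix.diagonal h * p).trace) =
      -(8 * a ^ 2 * b ^ 2) * (d * (Matrix.diagonal h * p).trace - p.trace * ∑ i, h i) := by
  simp_rw [trace_diagonal_mul_planeReflection_conj hab h hp]
  have hanti : ∑ k : Fin d × Fin d, (h k.1 - h k.2) * p k.1 k.2 = 0 := by
    have h1 : ∑ k : Fin d × Fin d, (h k.1 - h k.2) * p k.1 k.2 =
        ∑ k : Fin d × Fin d, (h k.2 - h k.1) * p k.2 k.1 :=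
      (Equiv.sum_comp (Equiv.prodComm (Fin d) (Fin d))
        (fun k => (h k.1 - h k.2) * p k.1 k.2)).symm
    have h2 : ∀ k : Fin d × Fin d, (h k.2 - h k.1) * p k.2 k.1 =
        -((h k.1 - h k.2) * p k.1 k.2) := by
      intro k
      rw [show p k.2 k.1 = p k.1 k.2 from congrFun (congrFun hp k.1) k.2]
      ring
    simp_rw [h2, Finset.sum_neg_distrib] at h1
    linarith
  have hdiag : ∑ k : Fin d × Fin d, (h k.1 - h k.2) * (p k.2 k.2 - p k.1 k.1) =
      -2 * (d * (Matrix.diagonal h * p).trace - p.trace * ∑ i, h i) := by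
    simpa only [Matrix.trace, Matrix.diag_apply, Matrix.diagonal_mul] using
      sum_sub_mul_sub h fun i => p i i
  calc _ = 4 * a ^ 2 * b ^ 2 * ∑ k : Fin d × Fin d, (h k.1 - h k.2) * (p k.2 k.2 - p k.1 k.1) -
        4 * (1 - 2 * a ^ 2) * a * b * ∑ k : Fin d × Fin d, (h k.1 - h k.2) * p k.1 k.2 := by
        rw [Finset.mul_sum, Finset.mul_sum, ← Finset.sum_sub_distrib]
        exact Finset.sum_congr rfl fun _ _ => by ring
    _ = _ := by rw [hanti, hdiag]; ring

/-- For a symmetric idempotent, `∑ p_ij² = Tr p`. By `(x - y)² ≤ 2x² + 2y²`, the off-diagonal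
entries contribute `32a²b² Tr p` and the diagonal ones `64a⁴b⁴d Tr p`. The condition `4a²b²d ≤ 1`
brings the latter down to `16a²b² Tr p`: small reflection parameters are what gain the factor `1/d`
in the variance proxy. -/
theorem sum_trace_sub_sq_le {a b L : ℝ} (hab : a ^ 2 + b ^ 2 = 1)
    (hd : 4 * a ^ 2 * b ^ 2 * d ≤ 1) {h : Fin d → ℝ} (h0 : ∀ i, 0 ≤ h i) (hL : ∀ i, h i ≤ L)
    {p : Matrix (Fin d) (Fin d) ℝ} (hp : pᵀ = p) (hpp : p * p = p) :
    ∑ k : Fin d × Fin d,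
      ((Matrix.diagonal h * (planeReflection a b k.1 k.2 * p * planeReflection a b k.1 k.2)).trace -
        (Matrix.diagonal h * p).trace) ^ 2 ≤ 48 * a ^ 2 * b ^ 2 * L ^ 2 * p.trace := by
  simp_rw [trace_diagonal_mul_planeReflection_conj hab h hp]
  have hsq : ∑ k : Fin d × Fin d, p k.1 k.2 ^ 2 = p.trace := by
    conv_rhs => rw [← hpp]
    rw [Fintype.sum_prod_type]
    simp only [Matrix.trace, Matrix.diag_apply, Matrix.mul_apply]
    refine Finset.sum_congr rfl fun i _ => Finset.sum_congr rfl fun j _ => ?_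
    rw [show p j i = p i j from congrFun (congrFun hp i) j]
    ring
  have hdg : ∑ i, p i i ^ 2 ≤ p.trace := by
    rw [← hsq, Fintype.sum_prod_type]
    exact Finset.sum_le_sum fun i _ =>
      Finset.single_le_sum (f := fun j => p i j ^ 2) (fun j _ => sq_nonneg _) (Finset.mem_univ i)
  have hdiff : ∑ k : Fin d × Fin d, (p k.2 k.2 - p k.1 k.1) ^ 2 ≤ 2 * d * p.trace := by
    have : ∑ k : Fin d × Fin d, (p k.2 k.2 - p k.1 k.1) ^ 2 =
        2 * d * ∑ i, p i i ^ 2 - 2 * (∑ i, p i i) ^ 2 := by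
      rw [Fintype.sum_prod_type]
      simp only [sub_sq, Finset.sum_add_distrib, Finset.sum_sub_distrib, ← Finset.mul_sum,
        ← Finset.sum_mul, Finset.sum_const, Finset.card_univ, Fintype.card_fin, nsmul_eq_mul]
      ring
    rw [this]
    have := mul_le_mul_of_nonneg_left hdg (by positivity : (0 : ℝ) ≤ 2 * d)
    nlinarith [sq_nonneg (∑ i, p i i)]
  have hc : (1 - 2 * a ^ 2) ^ 2 ≤ 1 := by nlinarith [sq_nonneg a, sq_nonneg b, sq_nonneg (a * b)]
  have htr : 0 ≤ p.trace := by rw [← hsq]; positivity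
  have hterm : ∀ k : Fin d × Fin d,
      ((h k.1 - h k.2) * (4 * a ^ 2 * b ^ 2 * (p k.2 k.2 - p k.1 k.1) -
        4 * (1 - 2 * a ^ 2) * a * b * p k.1 k.2)) ^ 2 ≤
      L ^ 2 * (2 * (4 * a ^ 2 * b ^ 2) ^ 2 * (p k.2 k.2 - p k.1 k.1) ^ 2 +
        32 * a ^ 2 * b ^ 2 * p k.1 k.2 ^ 2) := by
    intro k
    rw [mul_pow]
    have hh : (h k.1 - h k.2) ^ 2 ≤ L ^ 2 := by
      have := h0 k.1; have := h0 k.2; have := hL k.1; have := hL k.2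
      exact sq_le_sq' (by linarith) (by linarith)
    refine mul_le_mul hh ?_ (sq_nonneg _) (sq_nonneg _)
    have h1 := sq_nonneg (4 * a ^ 2 * b ^ 2 * (p k.2 k.2 - p k.1 k.1) +
      4 * (1 - 2 * a ^ 2) * a * b * p k.1 k.2)
    have h2 := mul_le_mul_of_nonneg_right hc
      (by positivity : 0 ≤ 32 * a ^ 2 * b ^ 2 * p k.1 k.2 ^ 2)
    nlinarith
  refine (Finset.sum_le_sum fun k _ => hterm k).trans ?_
  rw [← Finset.mul_sum, Finset.sum_add_distrib, ← Finset.mul_sum, ← Finset.mul_sum, hsq]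
  have h3 := mul_le_mul_of_nonneg_left hdiff (by positivity : 0 ≤ 2 * (4 * a ^ 2 * b ^ 2) ^ 2)
  have h4 := mul_le_mul_of_nonneg_right hd
    (by positivity : 0 ≤ 16 * a ^ 2 * b ^ 2 * p.trace)
  have h5 : 2 * (4 * a ^ 2 * b ^ 2) ^ 2 * ∑ k : Fin d × Fin d, (p k.2 k.2 - p k.1 k.1) ^ 2 +
      32 * a ^ 2 * b ^ 2 * p.trace ≤ 48 * a ^ 2 * b ^ 2 * p.trace := by
    nlinarith
  calc _ ≤ L ^ 2 * (48 * a ^ 2 * b ^ 2 * p.trace) :=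
        mul_le_mul_of_nonneg_left h5 (sq_nonneg L)
    _ = _ := by ring

end Reflection

/-! ### Projections, their laws, and transfer to the orthogonal group. -/

section Grassmannian

variable {d s : ℕ}

/-- `U Uᵀ e_j` lies in the column span, and the residual is orthogonal to it because `Uᵀ(1 - U Uᵀ) =
0`. -/
theorem proj_columnSpan (U : Stiefel d s) (i j : Fin d) :
    (columnSpan U).proj i j = lowRankProjection U i j := by
  have key : (LinearMap.range (Matrix.toEuclideanLin (𝕜 := ℝ) U.1)).starProjection
      (EuclideanSpace.single j (1 : ℝ)) =
      Matrix.toEuclideanLin (𝕜 := ℝ) U.1 (WithLp.toLp 2 (U.1ᵀ *ᵥ Pi.single j 1)) := by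
    refine Submodule.eq_starProjection_of_mem_of_inner_eq_zero
      (LinearMap.mem_range_self (Matrix.toEuclideanLin (𝕜 := ℝ) U.1) _) ?_
    rintro _ ⟨x, rfl⟩
    have h : U.1ᵀ *ᵥ (Pi.single j 1 - U.1 *ᵥ (U.1ᵀ *ᵥ Pi.single j 1)) = 0 := by
      rw [Matrix.mulVec_sub, Matrix.mulVec_mulVec, U.2, Matrix.one_mulVec, sub_self]
    have h2 : (U.1 *ᵥ x.ofLp) ⬝ᵥ (Pi.single j 1 - U.1 *ᵥ (U.1ᵀ *ᵥ Pi.single j 1)) = 0 := by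
      rw [dotProduct_comm, Matrix.dotProduct_mulVec, ← Matrix.mulVec_transpose, h, zero_dotProduct]
    rw [EuclideanSpace.inner_eq_star_dotProduct]
    simpa using h2
  change ((LinearMap.range (Matrix.toEuclideanLin (𝕜 := ℝ) U.1)).starProjection
      (EuclideanSpace.single j (1 : ℝ))) i = _
  rw [key]
  simp [lowRankProjection, Matrix.toLpLin_apply, Matrix.mul_apply, Matrix.mulVec, dotProduct]

/-- The alignment of the orthogonal projection onto a subspace. -/
noncomputable def grassmannianAlignment (H : Matrix (Fin d) (Fin d) ℝ) (V : Grassmannian d s) : ℝ :=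
  alignment H (Matrix.of V.proj)

theorem grassmannianAlignment_columnSpan (H : Matrix (Fin d) (Fin d) ℝ) (U : Stiefel d s) :
    grassmannianAlignment H (columnSpan U) = alignment H (lowRankProjection U) := by
  unfold grassmannianAlignment
  congr 1
  ext i j
  exact proj_columnSpan U i j

theorem continuous_alignment (H : Matrix (Fin d) (Fin d) ℝ) : Continuous (alignment H) := by
  unfold alignment
  fun_prop

theorem measurable_grassmannianAlignment (H : Matrix (Fin d) (Fin d) ℝ) :
    Measurable (grassmannianAlignment (s := s) H) := by
  have h1 : Measurable (Grassmannian.proj (d := d) (s := s)) := comap_measurable _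
  have h2 : Continuous fun g : Fin d → Fin d → ℝ => alignment H (Matrix.of g) :=
    (continuous_alignment H).comp continuous_id
  exact h2.measurable.comp h1

theorem continuous_lowRankProjection_firstColumns (h : s ≤ d) :
    Continuous fun Q : Matrix.orthogonalGroup (Fin d) ℝ =>
      lowRankProjection (firstColumns h Q) := by
  have h1 : Continuous fun Q : Matrix.orthogonalGroup (Fin d) ℝ =>
      Q.1.submatrix id (Fin.castLE h) := continuous_subtype_val.matrix_submatrix _ _
  exact h1.matrix_mul h1.matrix_transpose

theorem measurable_columnSpan_firstColumns (h : s ≤ d) :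
    Measurable fun Q : Matrix.orthogonalGroup (Fin d) ℝ => columnSpan (firstColumns h Q) := by
  refine measurable_comap_iff.2 ?_
  have : (Grassmannian.proj ∘ fun Q : Matrix.orthogonalGroup (Fin d) ℝ =>
      columnSpan (firstColumns h Q)) = fun Q i j => lowRankProjection (firstColumns h Q) i j := by
    ext Q i j
    exact proj_columnSpan _ i j
  rw [this]
  have hc : Continuous fun (Q : Matrix.orthogonalGroup (Fin d) ℝ) (i j : Fin d) =>
      lowRankProjection (firstColumns h Q) i j := continuous_lowRankProjection_firstColumns h
  exact hc.measurable

/-- The alignment factors through the span, so the law of the span suffices, whatever orthonormal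
basis `U` selects, and one may compute with Haar distributed `Q`. -/
theorem hasLaw_alignment_lowRankProjection {Ω : Type*} [MeasurableSpace Ω] {P : Measure Ω}
    (H : Matrix (Fin d) (Fin d) ℝ) (h : s ≤ d) {U : Ω → Stiefel d s}
    (hU : HasLaw (fun ω => columnSpan (U ω)) (uniformGrassmannian h) P) :
    HasLaw (fun ω => alignment H (lowRankProjection (U ω)))
      ((haarOrthogonal d).map fun Q => alignment H (lowRankProjection (firstColumns h Q))) P := by
  have hlaw : HasLaw (grassmannianAlignment (s := s) H)
      ((haarOrthogonal d).map fun Q => alignment H (lowRankProjection (firstColumns h Q)))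
      (uniformGrassmannian h) := by
    refine ⟨(measurable_grassmannianAlignment H).aemeasurable, ?_⟩
    rw [uniformGrassmannian, Measure.map_map (measurable_grassmannianAlignment H)
      (measurable_columnSpan_firstColumns h)]
    congr 1
    ext Q
    exact grassmannianAlignment_columnSpan H _
  simpa only [grassmannianAlignment_columnSpan] using hlaw.fun_comp hU

theorem lowRankProjection_mul (U : Stiefel d s) :
    lowRankProjection U * lowRankProjection U = lowRankProjection U := by
  have : U.1 * U.1ᵀ * (U.1 * U.1ᵀ) = U.1 * (U.1ᵀ * U.1) * U.1ᵀ := by simp only [Matrix.mul_assoc]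
  rw [lowRankProjection, this, U.2, Matrix.mul_one]

theorem lowRankProjection_transpose (U : Stiefel d s) :
    (lowRankProjection U)ᵀ = lowRankProjection U := by
  simp [lowRankProjection]

theorem trace_lowRankProjection (U : Stiefel d s) : (lowRankProjection U).trace = s := by
  rw [lowRankProjection, Matrix.trace_mul_comm, U.2]
  simp

theorem alignment_lowRankProjection (H : Matrix (Fin d) (Fin d) ℝ) (U : Stiefel d s) :
    alignment H (lowRankProjection U) = (H * lowRankProjection U).trace / lambdaMax H := by
  rw [alignment, lowRankProjection_transpose, Matrix.trace_mul_comm, ← Matrix.mul_assoc,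
    lowRankProjection_mul, Matrix.trace_mul_comm]

theorem lowRankProjection_firstColumns_mul (h : s ≤ d) (g Q : Matrix.orthogonalGroup (Fin d) ℝ) :
    lowRankProjection (firstColumns h (g * Q)) =
      g.1 * lowRankProjection (firstColumns h Q) * g.1ᵀ := by
  have h1 : (firstColumns h (g * Q)).1 = g.1 * (firstColumns h Q).1 := by
    ext i j
    simp [firstColumns, Matrix.mul_apply]
  rw [lowRankProjection, h1, lowRankProjection, Matrix.transpose_mul]
  simp only [Matrix.mul_assoc]

instance (d : ℕ) : IsProbabilityMeasure (haarOrthogonal d) :=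
  ⟨by simpa [haarOrthogonal] using
    Measure.haarMeasure_self (G := Matrix.orthogonalGroup (Fin d) ℝ) (K₀ := ⊤)⟩

instance (d : ℕ) : (haarOrthogonal d).IsMulLeftInvariant :=
  inferInstanceAs (Measure.haarMeasure _).IsMulLeftInvariant

theorem exists_orthogonal_diagonal {H : Matrix (Fin d) (Fin d) ℝ} (hH : H.PosSemidef) :
    ∃ (O : Matrix.orthogonalGroup (Fin d) ℝ) (h : Fin d → ℝ),
      H = O.1 * Matrix.diagonal h * O.1ᵀ ∧ ∀ i, 0 ≤ h i ∧ h i ≤ lambdaMax H := by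
  refine ⟨hH.1.eigenvectorUnitary, hH.1.eigenvalues, ?_, fun i => ⟨hH.eigenvalues_nonneg i, ?_⟩⟩
  · have := hH.1.spectral_theorem
    rw [Unitary.conjStarAlgAut_apply] at this
    simpa [Matrix.star_eq_conjTranspose] using! this
  · exact le_csSup H.finite_real_spectrum.bddAbove (hH.1.eigenvalues_mem_spectrum_real i)

end Grassmannian

/-! ### Mean and tail of the alignment of a uniform subspace. -/

section HaarConcentration

variable {d s : ℕ}

/-- With `a = cos x`, `b = sin x`, the second equation reads `sin²(2x) = 1/d`. -/
theorem exists_sq_add_sq_eq_one_of_pos (hd : 0 < d) :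
    ∃ a b : ℝ, a ^ 2 + b ^ 2 = 1 ∧ 4 * a ^ 2 * b ^ 2 * d = 1 := by
  have hd' : (1 : ℝ) ≤ d := by exact_mod_cast hd
  set x := Real.arcsin (Real.sqrt (1 / d)) / 2 with hx
  refine ⟨Real.cos x, Real.sin x, Real.cos_sq_add_sin_sq x, ?_⟩
  have h1 : Real.sin (2 * x) = Real.sqrt (1 / d) := by
    rw [hx, mul_div_cancel₀ _ two_ne_zero]
    refine Real.sin_arcsin (by linarith [Real.sqrt_nonneg (1 / (d : ℝ))]) ?_
    rw [Real.sqrt_le_one]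
    exact div_le_one_of_le₀ hd' (by positivity)
  have h2 : Real.sin (2 * x) ^ 2 = 1 / d := by rw [h1, Real.sq_sqrt (by positivity)]
  rw [Real.sin_two_mul] at h2
  field_simp at h2
  linarith

/-- The reflection `O R Oᵀ`, where `R` is the plane reflection of `planeReflection`. -/
def conjPlaneReflection (O : Matrix.orthogonalGroup (Fin d) ℝ) {a b : ℝ}
    (hab : a ^ 2 + b ^ 2 = 1) (k : Fin d × Fin d) : Matrix.orthogonalGroup (Fin d) ℝ :=
  O * ⟨planeReflection a b k.1 k.2, (Matrix.mem_orthogonalGroup_iff (Fin d) ℝ).2 (by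
    change planeReflection a b k.1 k.2 * (planeReflection a b k.1 k.2)ᵀ = 1
    rw [planeReflection_transpose, planeReflection_mul_self hab])⟩ * O⁻¹

theorem conjPlaneReflection_mul_self (O : Matrix.orthogonalGroup (Fin d) ℝ) {a b : ℝ}
    (hab : a ^ 2 + b ^ 2 = 1) (k : Fin d × Fin d) :
    conjPlaneReflection O hab k * conjPlaneReflection O hab k = 1 := by
  have h : ∀ R : Matrix.orthogonalGroup (Fin d) ℝ, R * R = 1 →
      O * R * O⁻¹ * (O * R * O⁻¹) = 1 := by
    intro R hR
    rw [show O * R * O⁻¹ * (O * R * O⁻¹) = O * (R * R) * O⁻¹ by group, hR]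
    group
  exact h _ (Subtype.ext (planeReflection_mul_self hab k.1 k.2))

theorem coe_conjPlaneReflection (O : Matrix.orthogonalGroup (Fin d) ℝ) {a b : ℝ}
    (hab : a ^ 2 + b ^ 2 = 1) (k : Fin d × Fin d) :
    (conjPlaneReflection O hab k).1 = O.1 * planeReflection a b k.1 k.2 * O.1ᵀ := rfl

theorem trace_conj_diagonal_mul (O p : Matrix (Fin d) (Fin d) ℝ) (h : Fin d → ℝ) :
    (O * Matrix.diagonal h * Oᵀ * p).trace = (Matrix.diagonal h * (Oᵀ * p * O)).trace := by
  rw [Matrix.mul_assoc, Matrix.mul_assoc, Matrix.trace_mul_comm]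
  simp only [Matrix.mul_assoc]

/-- Conjugating the reflections by the eigenbasis `O` reduces `H` to a diagonal matrix. In `γ /
(2V)` the factor `a²b²` cancels, leaving `d / (12 λ_max² s)`. -/
theorem haarOrthogonal_trace_concentration {H : Matrix (Fin d) (Fin d) ℝ} (hH : H.PosSemidef)
    (hlam : 0 < lambdaMax H) (hs : 0 < s) (hsd : s ≤ d) :
    ∫ Q, ((H * lowRankProjection (firstColumns hsd Q)).trace - s * H.trace / d)
        ∂haarOrthogonal d = 0 ∧
      ∀ t : ℝ, 0 ≤ t → (haarOrthogonal d).real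
        {Q | t ≤ (H * lowRankProjection (firstColumns hsd Q)).trace - s * H.trace / d} ≤
          Real.exp (-(t ^ 2 * d / (12 * lambdaMax H ^ 2 * s))) := by
  obtain ⟨O, h, hOH, hh⟩ := exists_orthogonal_diagonal hH
  have hd : 0 < d := hs.trans_le hsd
  obtain ⟨a, b, hab, habd⟩ := exists_sq_add_sq_eq_one_of_pos hd
  have hd' : (0 : ℝ) < d := by exact_mod_cast hd
  have hs' : (0 : ℝ) < s := by exact_mod_cast hs
  have hab0 : 0 < a ^ 2 * b ^ 2 := by
    by_contra hcon
    nlinarith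
  have hOO : O.1ᵀ * O.1 = 1 := (Matrix.mem_orthogonalGroup_iff' (Fin d) ℝ).1 O.2
  have hOO' : O.1 * O.1ᵀ = 1 := (Matrix.mem_orthogonalGroup_iff (Fin d) ℝ).1 O.2
  set f : Matrix.orthogonalGroup (Fin d) ℝ → ℝ := fun Q =>
    (H * lowRankProjection (firstColumns hsd Q)).trace - s * H.trace / d with hf
  set p : Matrix.orthogonalGroup (Fin d) ℝ → Matrix (Fin d) (Fin d) ℝ := fun Q =>
    O.1ᵀ * lowRankProjection (firstColumns hsd Q) * O.1 with hp
  have hpt : ∀ Q, (p Q)ᵀ = p Q := fun Q => by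
    simp only [hp, Matrix.transpose_mul, Matrix.transpose_transpose, lowRankProjection_transpose,
      Matrix.mul_assoc]
  have hpp : ∀ Q, p Q * p Q = p Q := fun Q => by
    simp only [hp]
    calc _ = O.1ᵀ * lowRankProjection (firstColumns hsd Q) * (O.1 * O.1ᵀ) *
          lowRankProjection (firstColumns hsd Q) * O.1 := by simp only [Matrix.mul_assoc]
      _ = O.1ᵀ * (lowRankProjection (firstColumns hsd Q) *
          lowRankProjection (firstColumns hsd Q)) * O.1 := by
        rw [hOO', Matrix.mul_one]; simp only [Matrix.mul_assoc]
      _ = _ := by rw [lowRankProjection_mul]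
  have hptr : ∀ Q, (p Q).trace = s := fun Q => by
    simp only [hp]
    rw [Matrix.trace_mul_comm, ← Matrix.mul_assoc, hOO', Matrix.one_mul, trace_lowRankProjection]
  have hHtr : H.trace = ∑ i, h i := by
    rw [hOH, Matrix.trace_mul_comm, ← Matrix.mul_assoc, hOO, Matrix.one_mul,
      Matrix.trace_diagonal]
  have hfp : ∀ Q, f Q = (Matrix.diagonal h * p Q).trace - s * H.trace / d := fun Q => by
    simp only [hf, hp]
    rw [← trace_conj_diagonal_mul, ← hOH]
  set T : Fin d × Fin d → Matrix.orthogonalGroup (Fin d) ℝ → Matrix.orthogonalGroup (Fin d) ℝ :=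
    fun k Q => conjPlaneReflection O hab k * Q with hT
  have hpT : ∀ k Q, p (T k Q) =
      planeReflection a b k.1 k.2 * p Q * planeReflection a b k.1 k.2 := fun k Q => by
    simp only [hp, hT]
    rw [lowRankProjection_firstColumns_mul, coe_conjPlaneReflection]
    simp only [Matrix.transpose_mul, Matrix.transpose_transpose, planeReflection_transpose]
    calc _ = (O.1ᵀ * O.1) * planeReflection a b k.1 k.2 * O.1ᵀ *
          lowRankProjection (firstColumns hsd Q) * O.1 * planeReflection a b k.1 k.2 *
          (O.1ᵀ * O.1) := by simp only [Matrix.mul_assoc]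
      _ = _ := by rw [hOO, Matrix.one_mul, Matrix.mul_one]; simp only [Matrix.mul_assoc]
  have hdiff : ∀ k Q, f (T k Q) - f Q =
      (Matrix.diagonal h * (planeReflection a b k.1 k.2 * p Q * planeReflection a b k.1 k.2)).trace
        - (Matrix.diagonal h * p Q).trace := fun k Q => by
    rw [hfp, hfp, hpT]; ring
  have hTm : ∀ k, MeasurePreserving (T k) (haarOrthogonal d) (haarOrthogonal d) := fun k =>
    measurePreserving_mul_left _ _
  have hfc : Continuous f := by
    have := continuous_lowRankProjection_firstColumns hsd
    exact ((continuous_const.matrix_mul this).matrix_trace).sub continuous_const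
  obtain ⟨K, hK⟩ := isCompact_univ.exists_bound_of_continuousOn hfc.continuousOn
  have hK' : ∀ Q, |f Q| ≤ K := fun Q => hK Q (Set.mem_univ Q)
  have hγ : 0 < 8 * a ^ 2 * b ^ 2 * d := by nlinarith
  have hlin : ∀ Q, ∑ k, (f (T k Q) - f Q) = -(8 * a ^ 2 * b ^ 2 * d) * f Q := fun Q => by
    simp_rw [hdiff]
    rw [sum_trace_sub_eq hab h (hpt Q), hptr, hfp, hHtr]
    field_simp
  have hquad : ∀ Q, ∑ k, (f (T k Q) - f Q) ^ 2 ≤ 48 * a ^ 2 * b ^ 2 * lambdaMax H ^ 2 * s :=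
    fun Q => by
      simp_rw [hdiff]
      rw [← hptr Q]
      exact sum_trace_sub_sq_le hab habd.le (fun i => (hh i).1) (fun i => (hh i).2) (hpt Q) (hpp Q)
  have hinv : ∀ k Q, T k (T k Q) = Q := fun k Q => by
    simp only [hT]
    rw [← mul_assoc, conjPlaneReflection_mul_self, one_mul]
  have hV : 0 < 48 * a ^ 2 * b ^ 2 * lambdaMax H ^ 2 * s := by
    have : 0 < (a ^ 2 * b ^ 2) * (48 * lambdaMax H ^ 2 * s) := by positivity
    linarith
  refine ⟨integral_eq_zero_of_sum_sub_eq_neg_mul hTm hfc.measurable hK' hγ hlin, fun t ht => ?_⟩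
  refine (measureReal_ge_le_of_sum_sub_eq_neg_mul hTm hinv hfc.measurable hK' hγ hV hlin hquad
    ht).trans (le_of_eq ?_)
  congr 2
  have ha : a ≠ 0 := by rintro rfl; simp at hab0
  have hb : b ≠ 0 := by rintro rfl; simp at hab0
  field_simp
  ring

theorem alignment_lowRankProjection_concentration {H : Matrix (Fin d) (Fin d) ℝ}
    (hH : H.PosSemidef) (hlam : 0 < lambdaMax H) (hs : 0 < s) (hsd : s ≤ d)
    {Ω : Type*} [MeasurableSpace Ω] {P : Measure Ω} {U : Ω → Stiefel d s}
    (hU : HasLaw (fun ω => columnSpan (U ω)) (uniformGrassmannian hsd) P) :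
    Integrable (fun ω => alignment H (lowRankProjection (U ω))) P ∧
      ∫ ω, alignment H (lowRankProjection (U ω)) ∂P = s * H.trace / (d * lambdaMax H) ∧
      ∀ t : ℝ, 0 ≤ t →
        P.real {ω | s * H.trace / (d * lambdaMax H) + t ≤ alignment H (lowRankProjection (U ω))} ≤
          Real.exp (-(d * t ^ 2 / (12 * s))) := by
  have hlaw := hasLaw_alignment_lowRankProjection H hsd hU
  set F : Matrix.orthogonalGroup (Fin d) ℝ → ℝ := fun Q =>
    alignment H (lowRankProjection (firstColumns hsd Q)) with hF
  have hFc : Continuous F :=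
    (continuous_alignment H).comp (continuous_lowRankProjection_firstColumns hsd)
  have hFlaw : HasLaw F ((haarOrthogonal d).map F) (haarOrthogonal d) :=
    ⟨hFc.measurable.aemeasurable, rfl⟩
  have hFi : Integrable F (haarOrthogonal d) := by
    obtain ⟨K, hK⟩ := isCompact_univ.exists_bound_of_continuousOn hFc.continuousOn
    exact Integrable.of_bound hFc.measurable.aestronglyMeasurable K
      (ae_of_all _ fun Q => hK Q (Set.mem_univ Q))
  have hd' : (0 : ℝ) < d := by exact_mod_cast hs.trans_le hsd
  have hs' : (0 : ℝ) < s := by exact_mod_cast hs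
  obtain ⟨hmean, htail⟩ := haarOrthogonal_trace_concentration hH hlam hs hsd
  have hFf : ∀ Q, (H * lowRankProjection (firstColumns hsd Q)).trace - s * H.trace / d =
      lambdaMax H * (F Q - s * H.trace / (d * lambdaMax H)) := fun Q => by
    simp only [hF, alignment_lowRankProjection]
    field_simp
  simp_rw [hFf] at hmean htail
  refine ⟨?_, ?_, fun t ht => ?_⟩
  · have hid : Integrable id ((haarOrthogonal d).map F) :=
      (integrable_map_measure aestronglyMeasurable_id hFc.measurable.aemeasurable).2 hFi
    rw [← hlaw.map_eq] at hid
    exact (integrable_map_measure aestronglyMeasurable_id hlaw.aemeasurable).1 hid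
  · rw [hlaw.integral_eq, ← hFlaw.integral_eq]
    rw [integral_const_mul, integral_sub hFi (integrable_const _)] at hmean
    have := (mul_eq_zero.1 hmean).resolve_left hlam.ne'
    simp at this
    linarith
  · have hm : MeasurableSet {x : ℝ | s * H.trace / (d * lambdaMax H) + t ≤ x} := measurableSet_Ici
    rw [hlaw.measureReal_eq hm, ← hFlaw.measureReal_eq hm]
    -- Scaling the threshold by `λ_max` cancels `λ_max²` in the exponent.
    convert! htail (lambdaMax H * t) (by positivity) using 3
    · ext Q
      rw [mul_le_mul_iff_right₀ hlam, le_sub_iff_add_le']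
    · field_simp

end HaarConcentration

/-! ### Diagonal entries, operator norm and intrinsic dimension. -/

section Spectral

variable {d : ℕ} {H : Matrix (Fin d) (Fin d) ℝ}

/-- A diagonal entry is an average of the eigenvalues, weighted by the squares of a row of an
orthogonal matrix. -/
theorem diag_le_lambdaMax (hH : H.PosSemidef) (i : Fin d) : H i i ≤ lambdaMax H := by
  obtain ⟨O, h, hOH, hh⟩ := exists_orthogonal_diagonal hH
  have hOO : O.1 * O.1ᵀ = 1 := (Matrix.mem_orthogonalGroup_iff (Fin d) ℝ).1 O.2
  have h1 : H i i = ∑ k, h k * O.1 i k ^ 2 := by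
    conv_lhs => rw [hOH]
    rw [Matrix.mul_apply]
    refine Finset.sum_congr rfl fun k _ => ?_
    rw [Matrix.mul_diagonal, Matrix.transpose_apply]
    ring
  have h2 : ∑ k, O.1 i k ^ 2 = 1 := by
    have := congrFun (congrFun hOO i) i
    rw [Matrix.mul_apply, Matrix.one_apply_eq] at this
    rw [← this]
    exact Finset.sum_congr rfl fun k _ => by rw [Matrix.transpose_apply]; ring
  calc H i i = ∑ k, h k * O.1 i k ^ 2 := h1
    _ ≤ ∑ k, lambdaMax H * O.1 i k ^ 2 :=
        Finset.sum_le_sum fun k _ => mul_le_mul_of_nonneg_right (hh k).2 (sq_nonneg _)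
    _ = lambdaMax H := by rw [← Finset.mul_sum, h2, mul_one]

open scoped Matrix.Norms.L2Operator in
theorem norm_toEuclideanCLM_le_lambdaMax (hH : H.PosSemidef) (hlam : 0 < lambdaMax H) :
    ‖Matrix.toEuclideanCLM (n := Fin d) (𝕜 := ℝ) H‖ ≤ lambdaMax H := by
  obtain ⟨O, h, hOH, hh⟩ := exists_orthogonal_diagonal hH
  change ‖H‖ ≤ lambdaMax H
  have h1 : ‖H‖ = ‖Matrix.diagonal h‖ := by
    conv_lhs => rw [hOH]
    have h2 := CStarRing.norm_mul_coe_unitary (O.1 * Matrix.diagonal h) (star O)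
    have h3 := CStarRing.norm_coe_unitary_mul O (Matrix.diagonal h)
    exact h2.trans h3
  rw [h1, Matrix.l2_opNorm_diagonal, pi_norm_le_iff_of_nonneg hlam.le]
  intro i
  rw [Real.norm_eq_abs, abs_of_nonneg (hh i).1]
  exact (hh i).2

theorem trace_div_lambdaMax_le_intdim (hH : H.PosSemidef) (hlam : 0 < lambdaMax H) :
    H.trace / lambdaMax H ≤ intdim H := by
  unfold intdim
  rcases (norm_nonneg (Matrix.toEuclideanCLM (n := Fin d) (𝕜 := ℝ) H)).eq_or_lt with h0 | h0
  -- With zero norm, `H = 0` and both quotients vanish.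
  · have : H = 0 := by
      have := norm_eq_zero.1 h0.symm
      exact (map_eq_zero_iff _ (Matrix.toEuclideanCLM (n := Fin d) (𝕜 := ℝ)).injective).1 this
    simp [this]
  · exact div_le_div_of_nonneg_left hH.trace_nonneg h0 (norm_toEuclideanCLM_le_lambdaMax hH hlam)

theorem alignment_diagonal (H : Matrix (Fin d) (Fin d) ℝ) (m : Fin d → ℝ) :
    alignment H (Matrix.diagonal m) = ∑ i, H i i / lambdaMax H * m i ^ 2 := by
  simp only [alignment, Matrix.diagonal_transpose, Matrix.trace, Matrix.diag_apply,
    Matrix.mul_diagonal, Matrix.diagonal_mul, Finset.sum_div]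
  exact Finset.sum_congr rfl fun i _ => by ring

end Spectral

/-! ### Independent Bernoulli masks. -/

section Bernoulli

variable {Ω : Type*} [MeasurableSpace Ω] {P : Measure Ω} {p : unitInterval}
  {X : Ω → ℝ}

theorem ae_sq_eq_self_of_hasLaw_bernoulliMeasure
    (hX : HasLaw X (bernoulliMeasure 1 0 p) P) : ∀ᵐ ω ∂P, X ω ^ 2 = X ω := by
  have hm : MeasurableSet {x : ℝ | x ^ 2 = x} :=
    measurableSet_eq_fun (by fun_prop) measurable_id
  rw [hX.ae_iff (p := fun x => x ^ 2 = x) (measurableSet_setOfPred.1 hm), bernoulliMeasure_def,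
    ae_add_measure_iff]
  constructor
  · exact Measure.ae_smul_measure ((ae_dirac_iff hm).2 (by simp)) _
  · exact Measure.ae_smul_measure ((ae_dirac_iff hm).2 (by simp)) _

theorem memLp_two_of_hasLaw_bernoulliMeasure [IsProbabilityMeasure P]
    (hX : HasLaw X (bernoulliMeasure 1 0 p) P) :
    MemLp X 2 P := by
  refine MemLp.of_bound hX.aemeasurable.aestronglyMeasurable 1 ?_
  filter_upwards [ae_sq_eq_self_of_hasLaw_bernoulliMeasure hX] with ω hω
  rw [Real.norm_eq_abs, abs_le]
  constructor <;> nlinarith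

theorem integral_of_hasLaw_bernoulliMeasure (hX : HasLaw X (bernoulliMeasure 1 0 p) P) :
    ∫ ω, X ω ∂P = p := by
  rw [hX.integral_eq, integral_bernoulliMeasure]
  simp

theorem variance_le_of_hasLaw_bernoulliMeasure [IsProbabilityMeasure P]
    (hX : HasLaw X (bernoulliMeasure 1 0 p) P) :
    Var[X; P] ≤ p := by
  rw [variance_eq_sub (memLp_two_of_hasLaw_bernoulliMeasure hX)]
  have h : P[X ^ 2] = (p : ℝ) := by
    rw [← integral_of_hasLaw_bernoulliMeasure hX]
    exact integral_congr_ae (ae_sq_eq_self_of_hasLaw_bernoulliMeasure hX)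
  rw [h]
  nlinarith [sq_nonneg (P[X])]

theorem alignment_bernoulli_concentration [IsProbabilityMeasure P] {d : ℕ}
    {H : Matrix (Fin d) (Fin d) ℝ} (hH : H.PosSemidef) (hlam : 0 < lambdaMax H)
    {m : Fin d → Ω → ℝ}
    (hm : ∀ i, HasLaw (m i) (bernoulliMeasure 1 0 p) P) (hind : iIndepFun m P) :
    Integrable (fun ω => alignment H (Matrix.diagonal fun i => m i ω)) P ∧
      ∫ ω, alignment H (Matrix.diagonal fun i => m i ω) ∂P = p * (H.trace / lambdaMax H) ∧
      ∀ t : ℝ, 0 < t →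
        P.real {ω | p * (H.trace / lambdaMax H) + t ≤
          alignment H (Matrix.diagonal fun i => m i ω)} ≤ p * (H.trace / lambdaMax H) / t ^ 2 := by
  set c : Fin d → ℝ := fun i => H i i / lambdaMax H with hc
  have hc0 : ∀ i, 0 ≤ c i := fun i => div_nonneg hH.diag_nonneg hlam.le
  have hc1 : ∀ i, c i ≤ 1 := fun i => div_le_one_of_le₀ (diag_le_lambdaMax hH i) hlam.le
  have hcs : ∑ i, c i = H.trace / lambdaMax H := by
    simp only [hc, ← Finset.sum_div, Matrix.trace, Matrix.diag_apply]
  set Y : Ω → ℝ := ∑ i, fun ω => c i * m i ω with hY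
  have hmem : ∀ i, MemLp (fun ω => c i * m i ω) 2 P := fun i =>
    (memLp_two_of_hasLaw_bernoulliMeasure (hm i)).const_mul (c i)
  have hYmem : MemLp Y 2 P := memLp_finsetSum' _ fun i _ => hmem i
  have hYi : Integrable Y P := hYmem.integrable one_le_two
  have hae : (fun ω => alignment H (Matrix.diagonal fun i => m i ω)) =ᵐ[P] Y := by
    have := ae_all_iff.2 fun i => ae_sq_eq_self_of_hasLaw_bernoulliMeasure (hm i)
    filter_upwards [this] with ω hω
    rw [alignment_diagonal, hY, Finset.sum_apply]
    exact Finset.sum_congr rfl fun i _ => by rw [hω i]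
  have hYmean : ∫ ω, Y ω ∂P = p * (H.trace / lambdaMax H) := by
    simp only [hY, Finset.sum_apply]
    rw [integral_finsetSum _ fun i _ => (hmem i).integrable one_le_two, ← hcs, Finset.mul_sum]
    refine Finset.sum_congr rfl fun i _ => ?_
    rw [integral_const_mul, integral_of_hasLaw_bernoulliMeasure (hm i), mul_comm]
  have hYvar : Var[Y; P] ≤ p * (H.trace / lambdaMax H) := by
    rw [hY, IndepFun.variance_sum (fun i _ => hmem i) fun i _ j _ hij =>
      (hind.indepFun hij).comp (measurable_const_mul (c i)) (measurable_const_mul (c j)),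
      ← hcs, Finset.mul_sum]
    refine Finset.sum_le_sum fun i _ => ?_
    rw [variance_const_mul]
    have h1 := variance_le_of_hasLaw_bernoulliMeasure (hm i)
    -- Here `H_ii ≤ λ_max` makes the variance bound linear in the trace, hence controlled by the
    -- intrinsic dimension.
    have h2 : c i ^ 2 ≤ c i := by nlinarith [hc0 i, hc1 i]
    calc _ ≤ c i * (p : ℝ) := mul_le_mul h2 h1 (variance_nonneg _ _) (hc0 i)
      _ = _ := mul_comm _ _
  refine ⟨hYi.congr hae.symm, (integral_congr_ae hae).trans hYmean, fun t ht => ?_⟩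
  have hcheb := meas_ge_le_variance_div_sq hYmem ht
  have hle : P {ω | p * (H.trace / lambdaMax H) + t ≤
      alignment H (Matrix.diagonal fun i => m i ω)} ≤ P {ω | t ≤ |Y ω - P[Y]|} := by
    refine measure_mono_ae ?_
    filter_upwards [hae] with ω hω h
    have h' : p * (H.trace / lambdaMax H) + t ≤ alignment H (Matrix.diagonal fun i => m i ω) := h
    change t ≤ |Y ω - P[Y]|
    rw [hYmean, ← hω]
    exact le_trans (by linarith) (le_abs_self _)
  refine (ENNReal.toReal_le_of_le_ofReal (by have := variance_nonneg Y P; positivity)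
    (hle.trans hcheb)).trans ?_
  gcongr

end Bernoulli

/-! ### A uniformly random block. -/

section Block

theorem alignment_blockMask {d : ℕ} (H : Matrix (Fin d) (Fin d) ℝ) (b : Finset (Fin d)) :
    alignment H (blockMask b) = (∑ i ∈ b, H i i) / lambdaMax H := by
  rw [blockMask, alignment_diagonal, Finset.sum_div]
  simp [ite_pow]

variable {Ω : Type*} [MeasurableSpace Ω] {P : Measure Ω} [IsProbabilityMeasure P]

theorem alignment_blockMask_distribution {d s N : ℕ} (hs : 0 < s) {H : Matrix (Fin d) (Fin d) ℝ}
    (hlam : 0 < lambdaMax H) {B : Fin N → Finset (Fin d)}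
    (hBs : ∀ j, (B j).card = s) (hB : ∀ i, ∃! j, i ∈ B j) {J : Ω → Fin N}
    (hJ : HasLaw J (uniformOn Set.univ) P) :
    Integrable (fun ω => alignment H (blockMask (B (J ω)))) P ∧
      ∫ ω, alignment H (blockMask (B (J ω))) ∂P = s * H.trace / (d * lambdaMax H) ∧
      ∀ t : ℝ, P.real {ω | t ≤ alignment H (blockMask (B (J ω)))} =
          1 / N * goodBlockCount H B t ∧
        P.real {ω | t ≤ alignment H (blockMask (B (J ω)))} = goodBlockCount H B t * s / d := by
  classical
  have hNe : Nonempty (Fin N) := by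
    -- A probability space has a point, and `J` maps it to an index, so `N > 0`.
    obtain ⟨ω⟩ := P.nonempty_of_neZero
    exact ⟨J ω⟩
  have hN : (0 : ℝ) < N := by exact_mod_cast Fin.pos_iff_nonempty.2 hNe
  have hs' : (0 : ℝ) < s := by exact_mod_cast hs
  have hdisj : ∀ j ∈ (Finset.univ : Finset (Fin N)), ∀ k ∈ (Finset.univ : Finset (Fin N)),
      j ≠ k → Disjoint (B j) (B k) := by
    intro j _ k _ hjk
    rw [Finset.disjoint_left]
    intro i hi hi'
    exact hjk ((hB i).unique hi hi')
  have hun : Finset.univ.biUnion B = Finset.univ := by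
    ext i
    obtain ⟨j, hj, -⟩ := hB i
    simpa using ⟨j, hj⟩
  have hd : (N : ℝ) * s = d := by
    have := Finset.card_biUnion hdisj
    rw [hun] at this
    simp only [Finset.card_univ, Fintype.card_fin, hBs, Finset.sum_const, smul_eq_mul] at this
    exact_mod_cast this.symm
  have htr : ∑ j, ∑ i ∈ B j, H i i = H.trace := by
    rw [← Finset.sum_biUnion (fun j _ k _ => hdisj j (Finset.mem_univ j) k (Finset.mem_univ k)),
      hun]
    rfl
  have hprob : IsProbabilityMeasure (uniformOn (Set.univ : Set (Fin N))) :=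
    isProbabilityMeasure_uniformOn Set.finite_univ Set.univ_nonempty
  set g : Fin N → ℝ := fun j => alignment H (blockMask (B j)) with hg
  have hreal : ∀ S : Finset (Fin N), (uniformOn (Set.univ : Set (Fin N))).real S =
      1 / N * S.card := by
    intro S
    rw [measureReal_def, uniformOn_univ]
    simp
    ring
  have hgi : Integrable g (uniformOn Set.univ) := Integrable.of_finite
  refine ⟨?_, ?_, fun t => ?_⟩
  · rw [← hJ.map_eq] at hgi
    exact hgi.comp_aemeasurable hJ.aemeasurable
  · rw [show ∫ ω, alignment H (blockMask (B (J ω))) ∂P = ∫ j, g j ∂uniformOn Set.univ from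
      hJ.integral_comp (f := g) hgi.aestronglyMeasurable, integral_fintype hgi]
    have h1 : ∀ j, (uniformOn (Set.univ : Set (Fin N))).real {j} = 1 / N := fun j => by
      simpa using hreal {j}
    simp only [h1, hg, alignment_blockMask, smul_eq_mul]
    rw [← Finset.mul_sum, ← Finset.sum_div, htr, ← hd]
    field_simp
  · have h1 : P.real {ω | t ≤ alignment H (blockMask (B (J ω)))} =
        1 / N * goodBlockCount H B t := by
      rw [hJ.measureReal_eq (p := fun j => t ≤ g j) (Set.toFinite _).measurableSet,
        goodBlockCount, ← hreal]
      congr 1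
      ext j
      simp only [hg, alignment_blockMask, le_div_iff₀' hlam]
      simp
    refine ⟨h1, h1.trans ?_⟩
    rw [← hd]
    field_simp

end Block

end SubspaceAlignment

theorem proposition2 :
    ∃ c₁ c₂ : ℝ, 0 < c₁ ∧ 0 < c₂ ∧
      ∀ (d : ℕ) (H : Matrix (Fin d) (Fin d) ℝ) (r : ℝ),
        H.PosSemidef → 0 < lambdaMax H → intdim H ≤ r → r ≤ d →
      ∀ (Ω : Type*) [MeasurableSpace Ω] (P : Measure Ω) [IsProbabilityMeasure P],
        -- low-rank projection onto a uniformly random `s`-dimensional subspace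
        (∀ (s : ℕ) (_ : 0 < s) (hsd : s ≤ d) (U : Ω → Stiefel d s) (ρ : Ω → ℝ),
          HasLaw (fun ω => columnSpan (U ω)) (uniformGrassmannian hsd) P →
          (∀ ω, ρ ω = alignment H (lowRankProjection (U ω))) →
            Integrable ρ P ∧ ∫ ω, ρ ω ∂P = s * H.trace / (d * lambdaMax H) ∧
            ∀ ρhat Δ : ℝ, ∫ ω, ρ ω ∂P < ρhat → Δ = ρhat - ∫ ω, ρ ω ∂P →
              P.real {ω | ρhat ≤ ρ ω} ≤ 2 * Real.exp (-(c₁ * (d * Δ ^ 2 / s)))) ∧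
        -- sparse perturbation by independent Bernoulli(`s / d`) masks
        (∀ (s : ℝ) (hs : 0 < s) (hsd : s ≤ d) (m : Fin d → Ω → ℝ) (ρ : Ω → ℝ),
          (∀ i, HasLaw (m i) (bernoulliMeasure 1 0 (maskProbability hs hsd)) P) →
          iIndepFun m P →
          (∀ ω, ρ ω = alignment H (Matrix.diagonal fun i => m i ω)) →
            Integrable ρ P ∧ ∫ ω, ρ ω ∂P = s * H.trace / (d * lambdaMax H) ∧
            ∀ ρhat Δ : ℝ, ∫ ω, ρ ω ∂P < ρhat → Δ = ρhat - ∫ ω, ρ ω ∂P →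
              P.real {ω | ρhat ≤ ρ ω} ≤ c₂ * (r * s / (d * Δ ^ 2))) ∧
        -- block sparse perturbation by a uniformly random block of a partition
        (∀ (s N : ℕ) (_ : 0 < s) (B : Fin N → Finset (Fin d)) (J : Ω → Fin N) (ρ : Ω → ℝ),
          (∀ j, (B j).card = s) → (∀ i, ∃! j, i ∈ B j) →
          HasLaw J (uniformOn Set.univ) P →
          (∀ ω, ρ ω = alignment H (blockMask (B (J ω)))) →
            Integrable ρ P ∧ ∫ ω, ρ ω ∂P = s * H.trace / (d * lambdaMax H) ∧
            ∀ ρhat : ℝ, ∫ ω, ρ ω ∂P < ρhat →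
              P.real {ω | ρhat ≤ ρ ω} = 1 / N * goodBlockCount H B ρhat ∧
              P.real {ω | ρhat ≤ ρ ω} = goodBlockCount H B ρhat * s / d) := by
  -- The exponent constant is `γ / (2V)` normalised, and Chebyshev's inequality gives `1`. The
  -- prefactor `2` in the first tail is slack, since the upper tail holds with `1`.
  refine ⟨1 / 12, 1, by norm_num, one_pos, ?_⟩
  intro d H r hH hlam hr _ Ω _ P _
  refine ⟨?_, ?_, ?_⟩
  · intro s hs hsd U ρ hU hρ
    obtain rfl : ρ = fun ω => alignment H (lowRankProjection (U ω)) := funext hρ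
    obtain ⟨h1, h2, h3⟩ := alignment_lowRankProjection_concentration hH hlam hs hsd hU
    refine ⟨h1, h2, fun ρhat Δ hlt hΔ => ?_⟩
    have h4 := h3 Δ (by linarith)
    rw [← h2, hΔ, add_sub_cancel] at h4
    rw [hΔ]
    refine h4.trans ?_
    rw [show ∀ x : ℝ, 1 / 12 * (d * x ^ 2 / s) = d * x ^ 2 / (12 * s) from fun x => by ring]
    linarith [Real.exp_pos (-(d * (ρhat - ∫ ω, alignment H (lowRankProjection (U ω)) ∂P) ^ 2 /
      (12 * s)))]
  · intro s hs hsd m ρ hm hind hρ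
    obtain rfl : ρ = fun ω => alignment H (Matrix.diagonal fun i => m i ω) := funext hρ
    obtain ⟨h1, h2, h3⟩ := alignment_bernoulli_concentration hH hlam hm hind
    have hp : (maskProbability hs hsd : ℝ) = s / d := rfl
    refine ⟨h1, by rw [h2, hp, div_mul_div_comm], fun ρhat Δ hlt hΔ => ?_⟩
    have h4 := h3 Δ (by linarith)
    rw [← h2, hΔ, add_sub_cancel, ← hΔ, h2, hp] at h4
    refine h4.trans ?_
    have h5 : H.trace / lambdaMax H ≤ r := (trace_div_lambdaMax_le_intdim hH hlam).trans hr
    rw [one_mul, show r * s / (d * Δ ^ 2) = s / d * r / Δ ^ 2 by ring]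
    gcongr
  · intro s N hs B J ρ hBs hB hJ hρ
    obtain rfl : ρ = fun ω => alignment H (blockMask (B (J ω))) := funext hρ
    obtain ⟨h1, h2, h3⟩ := alignment_blockMask_distribution hs hlam hBs hB hJ
    exact ⟨h1, h2, fun ρhat _ => h3 ρhat⟩
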